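/- Let $R$ be a commutative ring with identity. A finitely generated ideal $J$ of $R$ is a GV-ideal if the natural map $R\to \mathrm{Hom}_R(J,R)$, $r\mapsto (x\mapsto rx)$, is an isomorphism. For an $R$-module $X$ let $\mathrm{tor}_{GV}(X)=\{x\in X : Jx=0 \text{ for some GV-ideal } J\}$; $X$ is GV-torsion if $\mathrm{tor}_{GV}(X)=X$ and GV-torsionfree if $\mathrm{tor}_{GV}(X)=0$. A $w$-module is a GV-torsionfree module $X$ with $\mathrm{Ext}^1_R(R/J,X)=0$ for all GV-ideals $J$. For $X$ GV-torsionfree with injective envelope $E(X)$, put $X_w=\{x\in E(X): Jx\subseteq X\text{ for some GV-ideal }J\}$, and for any module $X$ put $L(X)=(X/\mathrm{tor}_{GV}(X))_w$. $X$ is $w$-projective if $\mathrm{Ext}^1_R(L(X),N)$ is GV-torsion for every $w$-module $N$ that is torsionfree (regular elements of $R$ act injectively on $N$). A homomorphism is a $w$-isomorphism if its localization at every maximal $w$-ideal (an ideal maximal among the proper ideals that are $w$-modules) is an isomorphism; $X$ is $w$-countably generated if there is a $w$-isomorphism $X_0\to X$ with $X_0$ countably generated. A short exact sequence $0\to A\to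 B\xrightarrow{g} C\to 0$ is $w$-split if there are $d_1,\dots,d_n\in R$ generating a GV-ideal and homomorphisms $h_1,\dots,h_n:C\to B$ with $g h_k=d_k\cdot \mathrm{id}_C$ for all $k$. A module $X$ is $w$-split if there is a $w$-split exact sequence $0\to K\to P\to X\to 0$ with $P$ projective. A $w$-split presentation $\xi$ of $M$ consists of a $w$-split exact sequence $0\to P\to F\xrightarrow{g} M\to 0$ with chosen $d_k$ and $h_k$ as above, and a decomposition $F=\bigoplus_{i\in I}F_i$ into countably generated projective submodules. For $H\subseteq I$ write $F(H)=\bigoplus_{i\in H}F_i$ and $M(H)=g(F(H))$. A continuous chain of submodules $(A_\lambda)_{\lambda\le\alpha}$, $\alpha$ an ordinal, satisfies $A_0=0$, $A_\lambda\subseteq A_{\lambda+1}$ for $\lambda<\alpha$, and $A_\lambda=\bigcup_{\mu<\lambda}A_\mu$ for limit ordinals $\lambda\le\alpha$. Theorem. Let $M$ be a $w$-projective $w$-module over $R$. Then: (1) $M$ can be filtered by countably generated $w$-split modules: $M$ has a $w$-split presentation, and for every $w$-split presentation $\xi$ of $M$ there are an ordinal $\alpha$, a subset $H\subseteq I$ and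 subsets $H_\lambda\subseteq H$ ($\lambda\le\alpha$) with $H_0=\emptyset$, $H_\alpha=H$, such that $(M(H_\lambda))_{\lambda\le\alpha}$ is a continuous chain with $M(H_\alpha)=M$; $h_k(M(H_\lambda))\subseteq F(H_\lambda)$ for all $k$ and all $\lambda\le\alpha$ (that is, $M(H_\lambda)$ is a $w$-split module induced by $\xi$ with respect to $H_\lambda$); and for each $\lambda<\alpha$ the module $M(H_{\lambda+1})/M(H_\lambda)$ is countably generated and $w$-split. (2) $M$ can be filtered by $w$-countably generated $w$-projective modules: there are an ordinal $\alpha$ and a continuous chain $(M'_\lambda)_{\lambda\le\alpha}$ of submodules of $M$ with $M'_\alpha=M$, such that each $M'_\lambda$ is a $w$-projective $w$-module and, for each $\lambda<\alpha$, $M'_{\lambda+1}/M'_\lambda$ is $w$-countably generated and $w$-projective. -/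

import Mathlib

universe u

open CategoryTheory

noncomputable section

namespace WKaplansky

/-! ### Glaz-Vasconcelos ideals and the torsion theory they define -/

section GV

variable {R : Type u} [CommRing R]

/-- `J` is a GV-ideal: `J` is finitely generated and the natural map
`R → Hom_R(J, R)`, `r ↦ (x ↦ r x)`, is an isomorphism. -/
def IsGVIdeal (J : Ideal R) : Prop :=
  J.FG ∧ Function.Bijective (LinearMap.toSpanSingleton R (J →ₗ[R] R) J.subtype)

theorem isGVIdeal_top : IsGVIdeal (⊤ : Ideal R) := by
  refine ⟨Ideal.fg_top R, ?_, ?_⟩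
  · intro r s h
    simpa using LinearMap.congr_fun h ⟨1, trivial⟩
  · intro φ
    refine ⟨φ ⟨1, trivial⟩, ?_⟩
    ext ⟨x, hx⟩
    have h1 : (⟨x, hx⟩ : (⊤ : Ideal R)) = x • ⟨1, trivial⟩ := by ext; simp
    rw [h1, map_smul, LinearMap.toSpanSingleton_apply, map_smul]
    simp [mul_comm]

theorem IsGVIdeal.eq_zero {J : Ideal R} (hJ : IsGVIdeal J) {r : R}
    (h : ∀ x ∈ J, r * x = 0) : r = 0 := by
  apply hJ.2.1
  ext ⟨x, hx⟩
  simpa using h x hx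

theorem IsGVIdeal.exists_mul {J : Ideal R} (hJ : IsGVIdeal J) (φ : J →ₗ[R] R) :
    ∃ r : R, ∀ x : J, φ x = r * x := by
  obtain ⟨r, hr⟩ := hJ.2.2 φ
  exact ⟨r, fun x => by rw [← hr]; simp⟩

theorem IsGVIdeal.mul {J K : Ideal R} (hJ : IsGVIdeal J) (hK : IsGVIdeal K) :
    IsGVIdeal (J * K) := by
  refine ⟨hJ.1.mul hK.1, ?_, ?_⟩
  · rw [injective_iff_map_eq_zero]
    intro r hr
    refine hJ.eq_zero fun a ha => hK.eq_zero fun b hb => ?_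
    have := LinearMap.congr_fun hr ⟨a * b, Ideal.mul_mem_mul ha hb⟩
    simpa [mul_assoc] using this
  · intro φ
    have h1 : ∀ a : J, ∃ c : R, ∀ b : K,
        φ ⟨a * b, Ideal.mul_mem_mul a.2 b.2⟩ = c * b := by
      intro a
      obtain ⟨c, hc⟩ := hK.exists_mul
        { toFun := fun b : K => φ ⟨a * b, Ideal.mul_mem_mul a.2 b.2⟩
          map_add' := fun x y => by
            rw [← map_add]; congr 1; ext; simp [mul_add]
          map_smul' := fun t x => by
            rw [RingHom.id_apply, ← map_smul]; congr 1; ext; simp [mul_left_comm] }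
      exact ⟨c, hc⟩
    choose c hc using h1
    have key : ∀ s t : R, (∀ b : K, s * b = t * b) → s = t := fun s t h =>
      sub_eq_zero.1 (hK.eq_zero fun x hx => by rw [sub_mul, h ⟨x, hx⟩, sub_self])
    obtain ⟨r, hr⟩ := hJ.exists_mul
      { toFun := c
        map_add' := fun x y => key _ _ fun b => by
          rw [add_mul, ← hc, ← hc, ← hc, ← map_add]; congr 1; ext; simp [add_mul]
        map_smul' := fun t x => key _ _ fun b => by
          rw [RingHom.id_apply, smul_eq_mul, mul_assoc, ← hc x, ← hc (t • x), ← smul_eq_mul t,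
            ← φ.map_smul]
          congr 1; ext; simp [mul_assoc] }
    refine ⟨r, ?_⟩
    ext ⟨x, hx⟩
    simp only [LinearMap.toSpanSingleton_apply, LinearMap.smul_apply, Submodule.subtype_apply,
      smul_eq_mul]
    induction hx using Submodule.mul_induction_on' with
    | mem_mul_mem a ha b hb =>
      have h2 := hr ⟨a, ha⟩
      have h3 := hc ⟨a, ha⟩ ⟨b, hb⟩
      simp only [LinearMap.coe_mk, AddHom.coe_mk] at h2
      rw [h3, h2, mul_assoc]
    | add x hx y hy h4 h5 =>
      have : (⟨x + y, add_mem hx hy⟩ : ↥(J * K)) = ⟨x, hx⟩ + ⟨y, hy⟩ := rfl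
      rw [this, map_add, ← h4, ← h5, mul_add]

variable {M : Type*} [AddCommGroup M] [Module R M]

/-- For a submodule `N` of `E`, the submodule `{x ∈ E | J x ⊆ N for some GV-ideal J}`. -/
def gvClosure (N : Submodule R M) : Submodule R M where
  carrier := {x | ∃ J : Ideal R, IsGVIdeal J ∧ ∀ a ∈ J, a • x ∈ N}
  zero_mem' := ⟨⊤, isGVIdeal_top, fun a _ => by rw [smul_zero]; exact N.zero_mem⟩
  add_mem' := fun {x y} ⟨J, hJ, hx⟩ ⟨K, hK, hy⟩ =>
    ⟨J * K, hJ.mul hK, fun a ha => by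
      rw [smul_add]
      exact N.add_mem (hx a ((Ideal.mul_le_inf ha).1)) (hy a ((Ideal.mul_le_inf ha).2))⟩
  smul_mem' := fun r x ⟨J, hJ, hx⟩ =>
    ⟨J, hJ, fun a ha => by rw [smul_comm]; exact N.smul_mem r (hx a ha)⟩

variable (R M)

/-- `tor_GV(M) = {x ∈ M | J x = 0 for some GV-ideal J}`. -/
def torGV : Submodule R M := gvClosure ⊥

/-- `M` is GV-torsion: `tor_GV(M) = M`. -/
def IsGVTorsion : Prop := torGV R M = ⊤

/-- `M` is GV-torsionfree: `tor_GV(M) = 0`. -/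
def IsGVTorsionFree : Prop := torGV R M = ⊥

/-- `M` is generated by a countable (possibly finite or empty) set. -/
def IsCountablyGenerated : Prop :=
  ∃ s : Set M, s.Countable ∧ Submodule.span R s = ⊤

end GV

/-! ### `w`-modules, `w`-envelopes and `w`-projective modules -/

section WModules

variable (R : Type u) [CommRing R] (M : Type u) [AddCommGroup M] [Module R M]

/-- `M` is a `w`-module: it is GV-torsionfree and `Ext¹_R(R/J, M) = 0` for all GV-ideals `J`. -/
def IsWModule : Prop :=
  IsGVTorsionFree R M ∧ ∀ J : Ideal R, IsGVIdeal J →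
    Subsingleton (Abelian.Ext (ModuleCat.of R (R ⧸ J)) (ModuleCat.of R M) 1)

variable {R M} in
/-- The embedding `j : M → E` makes `E` an injective envelope of `M`: `E` is injective and
every nonzero submodule of `E` meets the image of `M`. -/
def IsInjectiveEnvelope {E : Type u} [AddCommGroup E] [Module R E] (j : M →ₗ[R] E) : Prop :=
  Module.Injective R E ∧ Function.Injective j ∧
    ∀ S : Submodule R E, S ⊓ LinearMap.range j = ⊥ → S = ⊥

variable {R M} in
/-- The `w`-envelope `M_w = {x ∈ E(M) | J x ⊆ M for some GV-ideal J}` of `M`, formed inside an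
injective envelope `j : M → E(M)`. -/
def wEnvelope {E : Type u} [AddCommGroup E] [Module R E] (j : M →ₗ[R] E) : Submodule R E :=
  gvClosure (LinearMap.range j)

/-- `M` is `w`-projective: with `L(M) = (M / tor_GV(M))_w`, the module `Ext¹_R(L(M), N)` is
GV-torsion for every `w`-module `N` that is torsionfree (regular elements of `R` act
injectively). Injective envelopes exist and are unique up to isomorphism over the module, so
`L(M)` may be formed in any one of them. -/
def IsWProjective : Prop :=
  ∃ (E : Type u) (_ : AddCommGroup E) (_ : Module R E) (j : (M ⧸ torGV R M) →ₗ[R] E),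
    IsInjectiveEnvelope j ∧
    ∀ (N : Type u) [AddCommGroup N] [Module R N], Module.IsTorsionFree R N → IsWModule R N →
      IsGVTorsion R (Abelian.Ext (ModuleCat.of R (wEnvelope j)) (ModuleCat.of R N) 1)

end WModules

/-! ### `w`-isomorphisms and `w`-countably generated modules -/

section WIso

variable {R : Type u} [CommRing R]

/-- A maximal `w`-ideal: an ideal maximal among the proper ideals that are `w`-modules. -/
def IsMaximalWIdeal (m : Ideal R) : Prop :=
  Maximal (fun I : Ideal R => I ≠ ⊤ ∧ IsWModule R I) m

/-- `f` is a `w`-isomorphism: `f_m` is an isomorphism for every maximal `w`-ideal `m`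
(maximal `w`-ideals are prime, so that one can localize at them). -/
def IsWIsomorphism {M N : Type u} [AddCommGroup M] [Module R M] [AddCommGroup N] [Module R N]
    (f : M →ₗ[R] N) : Prop :=
  ∀ (m : Ideal R) [m.IsPrime], IsMaximalWIdeal m →
    Function.Bijective (LocalizedModule.map m.primeCompl f)

variable (R) in
/-- `M` is `w`-countably generated: some countably generated module has a `w`-isomorphism
to `M`. -/
def IsWCountablyGenerated (M : Type u) [AddCommGroup M] [Module R M] : Prop :=
  ∃ (M₀ : Type u) (_ : AddCommGroup M₀) (_ : Module R M₀) (f : M₀ →ₗ[R] M),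
    IsCountablyGenerated R M₀ ∧ IsWIsomorphism f

end WIso

/-! ### `w`-split sequences and modules -/

section WSplit

variable {R : Type u} [CommRing R]

/-- The elements `d₁, …, dₙ` generate a GV-ideal, and the maps `h₁, …, hₙ : C → B` satisfy
`g ∘ hₖ = dₖ · id_C` for all `k`. -/
def IsWSplitting {B C : Type u} [AddCommGroup B] [Module R B] [AddCommGroup C] [Module R C]
    (g : B →ₗ[R] C) {n : ℕ} (d : Fin n → R) (h : Fin n → C →ₗ[R] B) : Prop :=
  IsGVIdeal (Ideal.span (Set.range d)) ∧ ∀ k, g ∘ₗ h k = d k • LinearMap.id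

/-- `0 → A → B → C → 0` is a `w`-split short exact sequence. -/
def IsWSplitExact {A B C : Type u} [AddCommGroup A] [Module R A] [AddCommGroup B] [Module R B]
    [AddCommGroup C] [Module R C] (f : A →ₗ[R] B) (g : B →ₗ[R] C) : Prop :=
  Function.Injective f ∧ Function.Exact f g ∧ Function.Surjective g ∧
    ∃ (n : ℕ) (d : Fin n → R) (h : Fin n → C →ₗ[R] B), IsWSplitting g d h

variable (R) in
/-- `M` is a `w`-split module: there is a `w`-split short exact sequence `0 → K → P → M → 0`
with `P` projective. -/
def IsWSplit (M : Type u) [AddCommGroup M] [Module R M] : Prop :=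
  ∃ (K : Type u) (_ : AddCommGroup K) (_ : Module R K)
    (P : Type u) (_ : AddCommGroup P) (_ : Module R P)
    (f : K →ₗ[R] P) (g : P →ₗ[R] M), Module.Projective R P ∧ IsWSplitExact f g

end WSplit

/-! ### Filtrations -/

section Filtrations

/-- The submodules `A_l`, `l ≤ α`, form a continuous chain: `A_0 = 0`, `A_l ⊆ A_{l+1}` for
`l < α`, and `A_l = ⋃_{μ < l} A_μ` for limit ordinals `l ≤ α`. -/
def IsContinuousChain {R : Type u} [CommRing R] {M : Type u} [AddCommGroup M] [Module R M]
    (α : Ordinal.{u}) (A : Ordinal.{u} → Submodule R M) : Prop :=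
  A 0 = ⊥ ∧ (∀ l < α, A l ≤ A (l + 1)) ∧
    ∀ l ≤ α, Order.IsSuccLimit l → ∀ x, x ∈ A l ↔ ∃ μ < l, x ∈ A μ

/-- A `w`-split presentation of `M`: a short exact sequence `0 → P → F → M → 0`, together with
elements `d₁, …, dₙ` generating a GV-ideal and maps `h₁, …, hₙ : M → F` showing that it is
`w`-split, and a decomposition of `F` as the internal direct sum of countably generated
projective submodules `F_i`, `i ∈ I`. -/
structure WSplitPresentation (R : Type u) [CommRing R] (M : Type u) [AddCommGroup M]
    [Module R M] where
  P : Type u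
  F : Type u
  [addCommGroupP : AddCommGroup P]
  [moduleP : Module R P]
  [addCommGroupF : AddCommGroup F]
  [moduleF : Module R F]
  f : P →ₗ[R] F
  g : F →ₗ[R] M
  f_injective : Function.Injective f
  exact : Function.Exact f g
  g_surjective : Function.Surjective g
  n : ℕ
  d : Fin n → R
  h : Fin n → M →ₗ[R] F
  splitting : IsWSplitting g d h
  I : Type u
  component : I → Submodule R F
  independent : iSupIndep component
  iSup_component : ⨆ i, component i = ⊤
  projective : ∀ i, Module.Projective R (component i)
  countablyGenerated : ∀ i, IsCountablyGenerated R (component i)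

attribute [instance] WSplitPresentation.addCommGroupP WSplitPresentation.moduleP
  WSplitPresentation.addCommGroupF WSplitPresentation.moduleF

variable {R : Type u} [CommRing R] {M : Type u} [AddCommGroup M] [Module R M]

/-- `F(H) = ⨁_{j ∈ H} F_j ⊆ F`. -/
def WSplitPresentation.subF (ξ : WSplitPresentation R M) (H : Set ξ.I) : Submodule R ξ.F :=
  ⨆ j ∈ H, ξ.component j

/-- `M(H) = g(F(H)) ⊆ M`. -/
def WSplitPresentation.subM (ξ : WSplitPresentation R M) (H : Set ξ.I) : Submodule R M :=
  (ξ.subF H).map ξ.g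

/-- `M(H)` is a `w`-split module induced by `ξ` with respect to `H`: every `h_k` maps `M(H)` into
`F(H)`, that is, the `h_k` restrict to maps showing that
`0 → f⁻¹(ker g ∩ F(H)) → F(H) → M(H) → 0` is `w`-split. -/
def WSplitPresentation.IsInduced (ξ : WSplitPresentation R M) (H : Set ξ.I) : Prop :=
  ∀ k, ξ.subM H ≤ (ξ.subF H).comap (ξ.h k)

/-- The submodule `N` of `M` is filtered, relative to `ξ`, by countably generated `w`-split
modules. The quotient in the last clause is `N_{l+1} / N_l`. -/
def WSplitPresentation.IsFilteredByCGWSplit (ξ : WSplitPresentation R M)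
    (N : Submodule R M) : Prop :=
  ∃ (α : Ordinal.{u}) (H : Set ξ.I) (Hs : Ordinal.{u} → Set ξ.I),
    (∀ l ≤ α, Hs l ⊆ H) ∧ Hs 0 = ∅ ∧ Hs α = H ∧
    IsContinuousChain α (fun l => ξ.subM (Hs l)) ∧ ξ.subM (Hs α) = N ∧
    (∀ l ≤ α, ξ.IsInduced (Hs l)) ∧
    ∀ l < α,
      IsCountablyGenerated R
        (ξ.subM (Hs (l + 1)) ⧸ (ξ.subM (Hs l)).submoduleOf (ξ.subM (Hs (l + 1)))) ∧
      IsWSplit R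
        (ξ.subM (Hs (l + 1)) ⧸ (ξ.subM (Hs l)).submoduleOf (ξ.subM (Hs (l + 1))))

variable (R M) in
/-- `M` is filtered by `w`-countably generated `w`-projective modules: it has a continuous chain
of `w`-projective `w`-submodules ending in `M` whose successive quotients are `w`-countably
generated and `w`-projective. -/
def IsFilteredByWCGWProjective : Prop :=
  ∃ (α : Ordinal.{u}) (A : Ordinal.{u} → Submodule R M),
    IsContinuousChain α A ∧ A α = ⊤ ∧
    (∀ l ≤ α, IsWProjective R (A l) ∧ IsWModule R (A l)) ∧
    ∀ l < α,
      IsWCountablyGenerated R (A (l + 1) ⧸ (A l).submoduleOf (A (l + 1))) ∧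
      IsWProjective R (A (l + 1) ⧸ (A l).submoduleOf (A (l + 1)))

end Filtrations

end WKaplansky

end

/-!
For a surjection `g : F → M` from a free module onto a `w`-projective `w`-module, the kernel of `g`
is a torsionfree `w`-module, so some GV-ideal `(d₁, …, dₙ)` kills the class of the extension in
`Ext¹(M, ker g)`; hence each `dₖ · id_M` lifts along `g`, and the sequence is `w`-split.

Let `hₖ` be such lifts for a presentation with `F = ⨁ F_i`. Each `hₖ (g (F_i))` lies in `F(s i)` for
a countable set `s i`. If `s i ⊆ H` for all `i ∈ H`, then `hₖ` maps `M(H)` into `F(H)`, and for two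
such sets `H ⊆ H'` the maps `g` and `hₖ` pass to `F(H') / F(H) ≅ F(H' \ H)` and `M(H') / M(H)`,
which is therefore `w`-split. Adding the elements of a well-ordered `I` one at a time, each together
with the countably many indices it requires, yields the first filtration. Since `F(H)` is
GV-closed, the same maps pass to the GV-closures of the `M(H)`, which yield the second.
-/

namespace WKaplansky

section GVClosure

variable {R : Type u} [CommRing R] {M N : Type*} [AddCommGroup M] [Module R M]
  [AddCommGroup N] [Module R N]

theorem le_gvClosure (S : Submodule R M) : S ≤ gvClosure S := fun _ hx =>
  ⟨⊤, isGVIdeal_top, fun a _ => S.smul_mem a hx⟩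

theorem gvClosure_mono {S T : Submodule R M} (h : S ≤ T) : gvClosure S ≤ gvClosure T :=
  fun _ ⟨J, hJ, hx⟩ => ⟨J, hJ, fun a ha => h (hx a ha)⟩

theorem gvClosure_top : gvClosure (⊤ : Submodule R M) = ⊤ :=
  top_le_iff.1 (le_gvClosure _)

theorem mem_gvClosure_iff_exists_fin {S : Submodule R M} {x : M} :
    x ∈ gvClosure S ↔ ∃ (n : ℕ) (d : Fin n → R),
      IsGVIdeal (Ideal.span (Set.range d)) ∧ ∀ k, d k • x ∈ S := by
  constructor
  · rintro ⟨J, hJ, hx⟩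
    obtain ⟨n, d, rfl⟩ := Submodule.fg_iff_exists_fin_generating_family.1 hJ.1
    exact ⟨n, d, hJ, fun k => hx (d k) (Ideal.subset_span ⟨k, rfl⟩)⟩
  · rintro ⟨n, d, hd, hx⟩
    have hspan : Ideal.span (Set.range d) ≤ S.comap (LinearMap.toSpanSingleton R M x) :=
      Ideal.span_le.2 (Set.range_subset_iff.2 hx)
    exact ⟨_, hd, hspan⟩

theorem IsGVIdeal.prod {ι : Type*} {J : ι → Ideal R} (s : Finset ι)
    (hJ : ∀ i ∈ s, IsGVIdeal (J i)) : IsGVIdeal (∏ i ∈ s, J i) :=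
  Finset.prod_induction J IsGVIdeal (fun _ _ => IsGVIdeal.mul)
    (Ideal.one_eq_top (R := R) ▸ isGVIdeal_top) hJ

theorem exists_isGVIdeal_smul_mem {ι : Type*} [Finite ι] {S : Submodule R M} {x : ι → M}
    (hx : ∀ i, x i ∈ gvClosure S) : ∃ J : Ideal R, IsGVIdeal J ∧ ∀ a ∈ J, ∀ i, a • x i ∈ S := by
  cases nonempty_fintype ι
  choose J hJ hJx using hx
  refine ⟨∏ i, J i, IsGVIdeal.prod _ fun i _ => hJ i, fun a ha i => hJx i a ?_⟩
  exact Ideal.le_of_dvd (Finset.dvd_prod_of_mem J (Finset.mem_univ i)) ha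

@[simp]
theorem gvClosure_gvClosure (S : Submodule R M) : gvClosure (gvClosure S) = gvClosure S := by
  refine le_antisymm (fun x hx => ?_) (le_gvClosure _)
  obtain ⟨n, d, hd, hdx⟩ := mem_gvClosure_iff_exists_fin.1 hx
  obtain ⟨K, hK, hKx⟩ := exists_isGVIdeal_smul_mem hdx
  refine ⟨K * Ideal.span (Set.range d), hK.mul hd, ?_⟩
  suffices K * Ideal.span (Set.range d) ≤ S.comap (LinearMap.toSpanSingleton R M x) from this
  refine Ideal.mul_le.2 fun a ha b hb => ?_
  rw [Submodule.mem_comap, LinearMap.toSpanSingleton_apply, mul_smul]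
  have hspan : Ideal.span (Set.range d) ≤
      S.comap (a • LinearMap.toSpanSingleton R M x) :=
    Ideal.span_le.2 (Set.range_subset_iff.2 (hKx a ha))
  exact hspan hb

theorem gvClosure_iSup_of_directed {ι : Type*} [Nonempty ι] {S : ι → Submodule R M}
    (hS : Directed (· ≤ ·) S) : gvClosure (⨆ i, S i) = ⨆ i, gvClosure (S i) := by
  refine le_antisymm (fun x hx => ?_) (iSup_le fun i => gvClosure_mono (le_iSup S i))
  obtain ⟨n, d, hd, hdx⟩ := mem_gvClosure_iff_exists_fin.1 hx
  choose i hi using fun k => (Submodule.mem_iSup_of_directed S hS).1 (hdx k)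
  obtain ⟨m, hm⟩ := hS.finite_le i
  exact Submodule.mem_iSup_of_mem m
    (mem_gvClosure_iff_exists_fin.2 ⟨n, d, hd, fun k => hm k (hi k)⟩)

theorem gvClosure_comap (f : M →ₗ[R] N) (S : Submodule R N) :
    gvClosure (S.comap f) = (gvClosure S).comap f := by
  ext x
  exact exists_congr fun J => and_congr_right fun _ => forall₂_congr fun a _ => by
    rw [Submodule.mem_comap, map_smul]

theorem gvClosure_submoduleOf_gvClosure (S : Submodule R M) :
    gvClosure (S.submoduleOf (gvClosure S)) = ⊤ := by
  rw [Submodule.submoduleOf, gvClosure_comap, Submodule.comap_subtype_self]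

end GVClosure

section GVTorsionFree

variable {R : Type u} [CommRing R] {M N : Type*} [AddCommGroup M] [Module R M]
  [AddCommGroup N] [Module R N]

theorem isGVTorsionFree_iff : IsGVTorsionFree R M ↔
    ∀ (J : Ideal R), IsGVIdeal J → ∀ x : M, (∀ a ∈ J, a • x = 0) → x = 0 := by
  rw [IsGVTorsionFree, eq_bot_iff]
  exact ⟨fun h J hJ x hx => h ⟨J, hJ, hx⟩, fun h x ⟨J, hJ, hx⟩ => h J hJ x hx⟩

theorem gvClosure_ker (hN : IsGVTorsionFree R N) (f : M →ₗ[R] N) :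
    gvClosure (LinearMap.ker f) = LinearMap.ker f := by
  rw [LinearMap.ker, gvClosure_comap]
  exact congrArg (Submodule.comap f) hN

theorem IsGVTorsionFree.of_injective (hN : IsGVTorsionFree R N) (f : M →ₗ[R] N)
    (hf : Function.Injective f) : IsGVTorsionFree R M := by
  rw [IsGVTorsionFree, torGV, ← LinearMap.ker_eq_bot.2 hf, gvClosure_ker hN]

theorem isGVTorsionFree_quotient {S : Submodule R M} (hS : gvClosure S = S) :
    IsGVTorsionFree R (M ⧸ S) := by
  refine Submodule.comap_injective_of_surjective S.mkQ_surjective ?_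
  rw [torGV, ← gvClosure_comap, Submodule.comap_bot, Submodule.ker_mkQ, hS]

theorem isGVTorsionFree_quotient_torGV : IsGVTorsionFree R (M ⧸ torGV R M) :=
  isGVTorsionFree_quotient (gvClosure_gvClosure ⊥)

theorem IsGVTorsionFree.linearMap_ext {X : Type*} [AddCommGroup X] [Module R X]
    (hN : IsGVTorsionFree R N) {i : X →ₗ[R] M} (hi : gvClosure (LinearMap.range i) = ⊤)
    {f g : M →ₗ[R] N} (h : f ∘ₗ i = g ∘ₗ i) : f = g := by
  have hrange : LinearMap.range i ≤ LinearMap.ker (f - g) := by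
    rw [LinearMap.range_le_ker_iff, LinearMap.sub_comp, h, sub_self]
  rw [← sub_eq_zero, ← LinearMap.ker_eq_top, eq_top_iff, ← hi, ← gvClosure_ker hN]
  exact gvClosure_mono hrange

end GVTorsionFree

section HasGVExtension

variable {R : Type u} [CommRing R] {M N X Y : Type*} [AddCommGroup M] [Module R M]
  [AddCommGroup N] [Module R N] [AddCommGroup X] [Module R X] [AddCommGroup Y] [Module R Y]

variable (R M) in
/-- Every homomorphism from a GV-ideal to `M` extends to `R`. This is the vanishing of
`Ext¹_R(R/J, M)` for all GV-ideals `J`, stated without `Ext`. -/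
def HasGVExtension : Prop :=
  ∀ J : Ideal R, IsGVIdeal J → ∀ φ : J →ₗ[R] M, ∃ m : M, ∀ a : J, φ a = (a : R) • m

theorem HasGVExtension.exists_extension (hM₀ : IsGVTorsionFree R M) (hM : HasGVExtension R M)
    (i : X →ₗ[R] Y) (hi : Function.Injective i) (hY : gvClosure (LinearMap.range i) = ⊤)
    (f : X →ₗ[R] M) : ∃ f' : Y →ₗ[R] M, f' ∘ₗ i = f := by
  -- The GV-closure of the graph of `f` along `i` is the graph of the extension.
  let G : Submodule R (Y × M) := gvClosure (LinearMap.range (i.prod f))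
  have hG_injective : Function.Injective (LinearMap.fst R Y M ∘ₗ G.subtype) := by
    refine (injective_iff_map_eq_zero _).2 ?_
    rintro ⟨⟨y, m⟩, J, hJ, hJym⟩ (rfl : y = 0)
    suffices m = 0 by subst this; rfl
    refine isGVTorsionFree_iff.1 hM₀ J hJ m fun a ha => ?_
    obtain ⟨x, hx⟩ := hJym a ha
    have hix : i x = 0 := (congrArg Prod.fst hx).trans (smul_zero a)
    have hfx : f x = a • m := congrArg Prod.snd hx
    rw [← hfx, (map_eq_zero_iff i hi).1 hix, map_zero]
  have hG_surjective : Function.Surjective (LinearMap.fst R Y M ∘ₗ G.subtype) := by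
    intro y
    obtain ⟨J, hJ, hJy⟩ : y ∈ gvClosure (LinearMap.range i) := hY ▸ trivial
    let ψ : J →ₗ[R] X := LinearMap.codRestrictOfInjective
      (LinearMap.toSpanSingleton R Y y ∘ₗ J.subtype) i hi fun a => hJy a a.2
    have hψ : ∀ a : J, i (ψ a) = (a : R) • y :=
      LinearMap.codRestrictOfInjective_comp_apply _ i hi _
    obtain ⟨m, hm⟩ := hM J hJ (f ∘ₗ ψ)
    exact ⟨⟨(y, m), J, hJ, fun a ha => ⟨ψ ⟨a, ha⟩, Prod.ext (hψ ⟨a, ha⟩) (hm ⟨a, ha⟩)⟩⟩, rfl⟩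
  obtain ⟨f', hf'⟩ := Submodule.exists_eq_graph (G := G) ⟨hG_injective, hG_surjective⟩
  refine ⟨f', LinearMap.ext fun x => ?_⟩
  have hx : (i x, f x) ∈ G := le_gvClosure _ ⟨x, rfl⟩
  rw [hf', LinearMap.mem_graph_iff] at hx
  exact hx.symm

theorem HasGVExtension.surjective (hX : HasGVExtension R X) (hY₀ : IsGVTorsionFree R Y)
    (i : X →ₗ[R] Y) (hi : Function.Injective i) (hY : gvClosure (LinearMap.range i) = ⊤) :
    Function.Surjective i := by
  obtain ⟨r, hr⟩ := hX.exists_extension (hY₀.of_injective i hi) i hi hY LinearMap.id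
  have hir : i ∘ₗ r = LinearMap.id := hY₀.linearMap_ext hY (by
    rw [LinearMap.comp_assoc, hr, LinearMap.comp_id, LinearMap.id_comp])
  exact fun y => ⟨r y, LinearMap.congr_fun hir y⟩

theorem HasGVExtension.gvClosure_eq {S : Submodule R M} (hS : HasGVExtension R S)
    (hM₀ : IsGVTorsionFree R M) : gvClosure S = S := by
  refine le_antisymm (fun x hx => ?_) (le_gvClosure S)
  have hsurj := hS.surjective (hM₀.of_injective _ (gvClosure S).injective_subtype)
    (Submodule.inclusion (le_gvClosure S)) (Submodule.inclusion_injective _) (by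
      rw [Submodule.range_inclusion]; exact gvClosure_submoduleOf_gvClosure S)
  obtain ⟨y, hy⟩ := hsurj ⟨x, hx⟩
  rw [← show (y : M) = x from congrArg Subtype.val hy]
  exact y.2

theorem HasGVExtension.of_gvClosure_eq (hM : HasGVExtension R M) {S : Submodule R M}
    (hS : gvClosure S = S) : HasGVExtension R S := by
  intro J hJ φ
  obtain ⟨m, hm⟩ := hM J hJ (S.subtype ∘ₗ φ)
  have hmS : m ∈ gvClosure S := ⟨J, hJ, fun a ha => hm ⟨a, ha⟩ ▸ (φ ⟨a, ha⟩).2⟩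
  exact ⟨⟨m, hS ▸ hmS⟩, fun a => Subtype.ext (hm a)⟩

theorem HasGVExtension.of_leftInverse (hM : HasGVExtension R M) (r : M →ₗ[R] N) (s : N →ₗ[R] M)
    (hrs : Function.LeftInverse r s) : HasGVExtension R N := by
  intro J hJ φ
  obtain ⟨m, hm⟩ := hM J hJ (s ∘ₗ φ)
  exact ⟨r m, fun a => by rw [← map_smul, ← hm, LinearMap.comp_apply, hrs]⟩

theorem IsGVTorsionFree.finsupp (hM : IsGVTorsionFree R M) (ι : Type*) :
    IsGVTorsionFree R (ι →₀ M) :=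
  isGVTorsionFree_iff.2 fun J hJ x hx => Finsupp.ext fun i =>
    isGVTorsionFree_iff.1 hM J hJ (x i) fun a ha => DFunLike.congr_fun (hx a ha) i

theorem HasGVExtension.finsupp (hM₀ : IsGVTorsionFree R M) (hM : HasGVExtension R M)
    (ι : Type*) : HasGVExtension R (ι →₀ M) := by
  classical
  intro J hJ φ
  choose c hc using fun i => hM J hJ (Finsupp.lapply i ∘ₗ φ)
  obtain ⟨t, ht⟩ := Submodule.fg_top J |>.2 hJ.1
  -- The values of `φ` at finitely many generators of `J` bound the support of `c`.
  have hc_support : ∀ i, c i ≠ 0 → i ∈ t.biUnion fun a => (φ a).support := by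
    intro i hi
    by_contra hit
    have hφ : Finsupp.lapply i ∘ₗ φ = 0 := LinearMap.ext_on ht fun a ha =>
      Finsupp.notMem_support_iff.1 fun h => hit (Finset.mem_biUnion.2 ⟨a, ha, h⟩)
    refine hi (isGVTorsionFree_iff.1 hM₀ J hJ _ fun a ha => ?_)
    rw [← hc i ⟨a, ha⟩, hφ, LinearMap.zero_apply]
  exact ⟨Finsupp.onFinset _ c hc_support, fun a => Finsupp.ext fun i => hc i a⟩

theorem isGVTorsionFree_self : IsGVTorsionFree R R :=
  isGVTorsionFree_iff.2 fun _ hJ r hr => hJ.eq_zero fun a ha => (mul_comm r a).trans (hr a ha)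

theorem hasGVExtension_self : HasGVExtension R R := fun _ hJ φ =>
  (hJ.exists_mul φ).imp fun r hr a => (hr a).trans (mul_comm r a)

theorem isGVTorsionFree_of_projective [Module.Projective R M] : IsGVTorsionFree R M := by
  obtain ⟨s, hs⟩ := Module.projective_def.1 (inferInstance : Module.Projective R M)
  exact (isGVTorsionFree_self.finsupp M).of_injective s hs.injective

theorem hasGVExtension_of_projective [Module.Projective R M] : HasGVExtension R M := by
  obtain ⟨s, hs⟩ := Module.projective_def.1 (inferInstance : Module.Projective R M)
  exact (hasGVExtension_self.finsupp isGVTorsionFree_self M).of_leftInverse _ s hs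

end HasGVExtension

section WModule

variable {R : Type u} [CommRing R]

theorem subsingleton_ext_quotient_iff {P N : Type u} [AddCommGroup P] [Module R P]
    [Module.Projective R P] [AddCommGroup N] [Module R N] (S : Submodule R P) :
    Subsingleton (Abelian.Ext (ModuleCat.of R (P ⧸ S)) (ModuleCat.of R N) 1) ↔
      ∀ φ : S →ₗ[R] N, ∃ ψ : P →ₗ[R] N, ψ ∘ₗ S.subtype = φ := by
  let C := ModuleCat.shortComplexOfCompEqZero S.subtype S.mkQ
    (LinearMap.exact_subtype_mkQ S).linearMap_comp_eq_zero
  have hC : C.ShortExact := ModuleCat.shortComplex_shortExact C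
    (LinearMap.exact_subtype_mkQ S) S.injective_subtype S.mkQ_surjective
  constructor
  · intro hExt φ
    obtain ⟨x, hx⟩ := Abelian.Ext.contravariant_sequence_exact₁ hC (ModuleCat.of R N)
      (Abelian.Ext.mk₀ (ModuleCat.ofHom φ)) (n₁ := 1) rfl (Subsingleton.elim (h := hExt) _ _)
    obtain ⟨ψ, rfl⟩ := (Abelian.Ext.mk₀_bijective _ _).2 x
    rw [Abelian.Ext.mk₀_comp_mk₀] at hx
    exact ⟨ψ.hom, congrArg ModuleCat.Hom.hom ((Abelian.Ext.mk₀_bijective _ _).1 hx)⟩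
  · intro h
    refine subsingleton_of_forall_eq 0 fun e => ?_
    have : Projective C.X₂ := inferInstanceAs (Projective (ModuleCat.of R P))
    obtain ⟨x, rfl⟩ := Abelian.Ext.contravariant_sequence_exact₃ hC (ModuleCat.of R N) e
      (Abelian.Ext.eq_zero_of_projective _) (n₀ := 0) rfl
    obtain ⟨φ, rfl⟩ := (Abelian.Ext.mk₀_bijective _ _).2 x
    obtain ⟨ψ, hψ⟩ := h φ.hom
    have hφ : φ = C.f ≫ ModuleCat.ofHom ψ := ModuleCat.hom_ext hψ.symm
    rw [hφ, ← Abelian.Ext.mk₀_comp_mk₀, ShortComplex.ShortExact.extClass_comp_assoc]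

theorem isWModule_iff {M : Type u} [AddCommGroup M] [Module R M] :
    IsWModule R M ↔ IsGVTorsionFree R M ∧ HasGVExtension R M := by
  refine and_congr_right fun _ => forall₂_congr fun J _ =>
    (subsingleton_ext_quotient_iff J).trans (forall_congr' fun φ => ?_)
  constructor
  · rintro ⟨ψ, rfl⟩
    exact ⟨ψ 1, fun a => by
      rw [← map_smul, smul_eq_mul, mul_one, LinearMap.comp_apply, Submodule.subtype_apply]⟩
  · rintro ⟨m, hm⟩
    exact ⟨LinearMap.toSpanSingleton R M m, LinearMap.ext fun a => (hm a).symm⟩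

theorem isWModule_of_projective {P : Type u} [AddCommGroup P] [Module R P]
    [Module.Projective R P] : IsWModule R P :=
  isWModule_iff.2 ⟨isGVTorsionFree_of_projective, hasGVExtension_of_projective⟩

theorem IsWModule.of_gvClosure_eq {M : Type u} [AddCommGroup M] [Module R M]
    (hM : IsWModule R M) {S : Submodule R M} (hS : gvClosure S = S) : IsWModule R S :=
  isWModule_iff.2 ⟨hM.1.of_injective _ S.injective_subtype,
    (isWModule_iff.1 hM).2.of_gvClosure_eq hS⟩

end WModule

section InjectiveEnvelope

variable {R : Type u} [CommRing R] {M : Type u} [AddCommGroup M] [Module R M]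

variable (R M) in
theorem exists_injective_embedding :
    ∃ (E : Type u) (_ : AddCommGroup E) (_ : Module R E) (j : M →ₗ[R] E),
      Module.Injective R E ∧ Function.Injective j := by
  let A : ModuleCat.{u} R := ModuleCat.of R M
  let E : ModuleCat.{u} R := Injective.under A
  have : Injective (ModuleCat.of R E) := inferInstanceAs (Injective (Injective.under A))
  exact ⟨E, inferInstance, inferInstance, (Injective.ι A).hom,
    Module.injective_module_of_injective_object R _,
    (ModuleCat.mono_iff_injective _).1 inferInstance⟩

/-- Every nonzero submodule of `E` meets `N`. For `N ≤ E` this says that `E` is an essential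
extension of `N`, so that a maximal such `E` inside an injective module is an injective
envelope of `N`. -/
def IsEssentialIn (N E : Submodule R M) : Prop :=
  ∀ S ≤ E, Disjoint S N → S = ⊥

theorem isEssentialIn_iff_forall_span_singleton {N E : Submodule R M} :
    IsEssentialIn N E ↔ ∀ x ∈ E, Disjoint (Submodule.span R {x}) N → x = 0 := by
  constructor
  · exact fun h x hx hdisj => Submodule.span_singleton_eq_bot.1
      (h _ ((Submodule.span_singleton_le_iff_mem x E).2 hx) hdisj)
  · exact fun h S hS hdisj => (Submodule.eq_bot_iff S).2 fun x hx => h x (hS hx)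
      (hdisj.mono_left ((Submodule.span_singleton_le_iff_mem x S).2 hx))

theorem exists_maximal_isEssentialIn (N : Submodule R M) :
    ∃ E, N ≤ E ∧ Maximal (IsEssentialIn N) E := by
  refine zorn_le_nonempty₀ {E | IsEssentialIn N E} (fun c hc hchain E hE => ?_) N
    fun S hS hdisj => hdisj.eq_bot_of_le hS
  refine ⟨sSup c, isEssentialIn_iff_forall_span_singleton.2 fun x hx => ?_, fun _ => le_sSup⟩
  obtain ⟨E', hE', hxE'⟩ := (Submodule.mem_sSup_of_directed ⟨E, hE⟩ hchain.directedOn).1 hx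
  exact isEssentialIn_iff_forall_span_singleton.1 (hc hE') x hxE'

theorem exists_maximal_disjoint (E : Submodule R M) : ∃ C, Maximal (Disjoint E) C := by
  obtain ⟨C, -, hC⟩ := zorn_le_nonempty₀ {C | Disjoint E C} (fun c hc hchain _ _ =>
    ⟨sSup c, hchain.directedOn.disjoint_sSup_right.2 fun _ hb => hc hb, fun _ => le_sSup⟩)
    ⊥ disjoint_bot_right
  exact ⟨C, hC⟩

theorem exists_retraction_of_maximal_isEssentialIn [Module.Injective R M] {N E : Submodule R M}
    (hE : Maximal (IsEssentialIn N) E) : ∃ r : M →ₗ[R] E, ∀ e : E, r e = e := by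
  obtain ⟨C, hC⟩ := exists_maximal_disjoint E
  have hEC : Function.Injective (C.mkQ ∘ₗ E.subtype) := by
    rw [← LinearMap.ker_eq_bot, LinearMap.ker_comp, Submodule.ker_mkQ,
      ← Submodule.disjoint_iff_comap_eq_bot]
    exact hC.prop
  obtain ⟨φ, hφ⟩ := Module.Injective.out (C.mkQ ∘ₗ E.subtype) hEC E.subtype
  let ψ : M →ₗ[R] M := φ ∘ₗ C.mkQ
  have hψE : ∀ e ∈ E, ψ e = e := fun e he => hφ ⟨e, he⟩
  have hψC : C ≤ LinearMap.ker ψ :=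
    C.ker_mkQ.ge.trans (LinearMap.ker_le_ker_comp _ _)
  have hE_le : E ≤ LinearMap.range ψ := fun e he => ⟨e, hψE e he⟩
  -- A submodule of the range missing `N` misses `E`, so its preimage misses `E` and is `C`.
  have hess : IsEssentialIn N (LinearMap.range ψ) := by
    intro S hS hSN
    have hES : Disjoint E (S.comap ψ) := Submodule.disjoint_def.2 fun e he heS => by
      have heS' : e ∈ S := hψE e he ▸ heS
      have hES' : E ⊓ S = ⊥ := hE.prop _ inf_le_left (hSN.mono_left inf_le_right)
      exact (Submodule.mem_bot R).1 (hES' ▸ ⟨he, heS'⟩)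
    have hSC : S.comap ψ ≤ C :=
      hC.le_of_ge hES (hψC.trans (Submodule.comap_mono bot_le))
    rw [← Submodule.map_comap_eq_of_le hS]
    exact LinearMap.le_ker_iff_map.1 (hSC.trans hψC)
  exact ⟨ψ.codRestrict E fun x => hE.le_of_ge hess hE_le ⟨x, rfl⟩,
    fun e => Subtype.ext (hψE e e.2)⟩

theorem injective_of_retraction {E : Type u} [AddCommGroup E] [Module R E] [Module.Injective R M]
    (i : E →ₗ[R] M) (r : M →ₗ[R] E) (hri : Function.LeftInverse r i) : Module.Injective R E where
  out _ _ _ _ _ _ f hf g := by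
    obtain ⟨k, hk⟩ := Module.Injective.out f hf (i ∘ₗ g)
    exact ⟨r ∘ₗ k, fun x => by rw [LinearMap.comp_apply, hk, LinearMap.comp_apply, hri]⟩

variable (R M) in
theorem exists_isInjectiveEnvelope :
    ∃ (E : Type u) (_ : AddCommGroup E) (_ : Module R E) (j : M →ₗ[R] E),
      IsInjectiveEnvelope j := by
  obtain ⟨I, _, _, i, hI, hi⟩ := exists_injective_embedding R M
  obtain ⟨E, hiE, hE⟩ := exists_maximal_isEssentialIn (LinearMap.range i)
  obtain ⟨r, hr⟩ := exists_retraction_of_maximal_isEssentialIn hE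
  let j : M →ₗ[R] E := i.codRestrict E fun m => hiE ⟨m, rfl⟩
  refine ⟨E, inferInstance, inferInstance, j, injective_of_retraction E.subtype r hr,
    (LinearMap.injective_codRestrict_iff _).2 hi, fun S hS => ?_⟩
  have hj : (LinearMap.range j).map E.subtype = LinearMap.range i := by
    rw [← LinearMap.range_comp, LinearMap.subtype_comp_codRestrict]
  refine Submodule.map_injective_of_injective E.injective_subtype
    ((hE.prop _ (Submodule.map_subtype_le E S) ?_).trans (Submodule.map_bot _).symm)
  rw [← hj, disjoint_iff, ← Submodule.map_inf _ E.injective_subtype, hS, Submodule.map_bot]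

theorem IsInjectiveEnvelope.isGVTorsionFree {E : Type u} [AddCommGroup E] [Module R E]
    {j : M →ₗ[R] E} (hj : IsInjectiveEnvelope j) (hM : IsGVTorsionFree R M) :
    IsGVTorsionFree R E := by
  refine hj.2.2 _ (eq_bot_iff.2 ?_)
  rintro _ ⟨hx, m, rfl⟩
  have hm : m ∈ torGV R M := by
    rwa [torGV, ← LinearMap.ker_eq_bot.2 hj.2.1, LinearMap.ker, gvClosure_comap]
  have hm₀ : m = 0 := (Submodule.mem_bot R).1 (hM ▸ hm)
  rw [hm₀, map_zero]
  exact zero_mem _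

end InjectiveEnvelope

section WSplit

variable {R : Type u} [CommRing R] {B C : Type u} [AddCommGroup B] [Module R B]
  [AddCommGroup C] [Module R C]

namespace IsWSplitting

variable {g : B →ₗ[R] C} {n : ℕ} {d : Fin n → R} {h : Fin n → C →ₗ[R] B}

theorem apply (hs : IsWSplitting g d h) (k : Fin n) (x : C) : g (h k x) = d k • x :=
  LinearMap.congr_fun (hs.2 k) x

theorem gvClosure_range (hs : IsWSplitting g d h) : gvClosure (LinearMap.range g) = ⊤ :=
  eq_top_iff.2 fun x _ =>
    mem_gvClosure_iff_exists_fin.2 ⟨n, d, hs.1, fun k => ⟨h k x, hs.apply k x⟩⟩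

theorem restrict (hs : IsWSplitting g d h) {S : Submodule R B} {T : Submodule R C}
    (hg : S ≤ T.comap g) (hh : ∀ k, T ≤ S.comap (h k)) :
    IsWSplitting (g.restrict hg) d (fun k => (h k).restrict (hh k)) :=
  ⟨hs.1, fun k => LinearMap.ext fun x => Subtype.ext (hs.apply k x)⟩

theorem mapQ (hs : IsWSplitting g d h) {S : Submodule R B} {T : Submodule R C}
    (hg : S ≤ T.comap g) (hh : ∀ k, T ≤ S.comap (h k)) :
    IsWSplitting (S.mapQ T g hg) d (fun k => T.mapQ S (h k) (hh k)) :=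
  ⟨hs.1, fun k => Submodule.linearMap_qext _
    (LinearMap.ext fun x => congrArg T.mkQ (hs.apply k x))⟩

theorem isWSplit [Module.Projective R B] (hs : IsWSplitting g d h) : IsWSplit R C := by
  -- `g` need not be surjective; adding a free module to `B` makes it so.
  let g' : B × (C →₀ R) →ₗ[R] C := g.coprod (Finsupp.linearCombination R id)
  have hg' : Function.Surjective g' := fun x => by
    obtain ⟨y, hy⟩ := Finsupp.linearCombination_id_surjective R C x
    exact ⟨(0, y), by rw [LinearMap.coprod_apply, map_zero, zero_add, hy]⟩
  refine ⟨LinearMap.ker g', inferInstance, inferInstance, B × (C →₀ R), inferInstance,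
    inferInstance, (LinearMap.ker g').subtype, g', inferInstance, Subtype.val_injective,
    LinearMap.exact_subtype_ker_map g', hg', n, d, fun k => LinearMap.inl R B _ ∘ₗ h k,
    hs.1, fun k => ?_⟩
  rw [← LinearMap.comp_assoc, LinearMap.coprod_inl, hs.2 k]

end IsWSplitting

theorem ext_smul_eq_zero_of_comp_eq_smul_id [Module.Projective R B] {N : Type u}
    [AddCommGroup N] [Module R N] (g : B →ₗ[R] C) (h : C →ₗ[R] B) {a : R}
    (hgh : g ∘ₗ h = a • LinearMap.id)
    (e : Abelian.Ext (ModuleCat.of R C) (ModuleCat.of R N) 1) : a • e = 0 := by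
  have hcomp : ModuleCat.ofHom h ≫ ModuleCat.ofHom g = a • 𝟙 (ModuleCat.of R C) :=
    ModuleCat.hom_ext hgh
  have hzero : (Abelian.Ext.mk₀ (ModuleCat.ofHom g)).comp e (zero_add 1) = 0 :=
    Abelian.Ext.eq_zero_of_projective _
  calc a • e
      = (Abelian.Ext.mk₀ (ModuleCat.ofHom h ≫ ModuleCat.ofHom g)).comp e (zero_add 1) := by
        rw [hcomp, Abelian.Ext.mk₀_smul, Abelian.Ext.smul_comp, Abelian.Ext.mk₀_id_comp]
    _ = 0 := by
        rw [← Abelian.Ext.mk₀_comp_mk₀_assoc, hzero, Abelian.Ext.comp_zero]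

theorem IsWSplit.isGVTorsion_ext (hC : IsWSplit R C) (N : Type u) [AddCommGroup N]
    [Module R N] : IsGVTorsion R (Abelian.Ext (ModuleCat.of R C) (ModuleCat.of R N) 1) := by
  obtain ⟨_, _, _, P, _, _, _, g, _, _, _, _, n, d, h, hd, hgh⟩ := hC
  exact eq_top_iff.2 fun e _ => mem_gvClosure_iff_exists_fin.2
    ⟨n, d, hd, fun k => ext_smul_eq_zero_of_comp_eq_smul_id g (h k) (hgh k) e⟩

theorem IsWSplit.of_gvClosure_range_eq_top (hB : IsWSplit R B) (hC : IsGVTorsionFree R C)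
    (i : B →ₗ[R] C) (hi : Function.Injective i) (hiC : gvClosure (LinearMap.range i) = ⊤) :
    IsWSplit R C := by
  obtain ⟨_, _, _, P, _, _, _, g, _, _, _, _, n, d, h, hs⟩ := hB
  choose h' hh' using fun k => hasGVExtension_of_projective.exists_extension
    isGVTorsionFree_of_projective i hi hiC (h k)
  have hs' : IsWSplitting (i ∘ₗ g) d h' := by
    refine ⟨hs.1, fun k => hC.linearMap_ext hiC ?_⟩
    rw [LinearMap.comp_assoc, hh' k, LinearMap.comp_assoc, hs.2 k, LinearMap.comp_smul,
      LinearMap.comp_id, LinearMap.smul_comp, LinearMap.id_comp]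
  exact hs'.isWSplit

end WSplit

section WProjective

variable {R : Type u} [CommRing R] {M : Type u} [AddCommGroup M] [Module R M]

/-- The canonical map `M → M / tor_GV(M) → L(M)`, where `L(M)` is the `w`-envelope of
`M / tor_GV(M)` formed along `j`. -/
def toWEnvelope {E : Type u} [AddCommGroup E] [Module R E] (j : (M ⧸ torGV R M) →ₗ[R] E) :
    M →ₗ[R] wEnvelope j :=
  (j ∘ₗ (torGV R M).mkQ).codRestrict (wEnvelope j)
    fun _ => show _ ∈ wEnvelope j from le_gvClosure _ ⟨_, rfl⟩

section ToWEnvelope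

variable {E : Type u} [AddCommGroup E] [Module R E] {j : (M ⧸ torGV R M) →ₗ[R] E}

theorem toWEnvelope_injective (hM : IsGVTorsionFree R M) (hj : Function.Injective j) :
    Function.Injective (toWEnvelope j) := by
  have hmkQ : Function.Injective (torGV R M).mkQ := by
    rw [← LinearMap.ker_eq_bot, Submodule.ker_mkQ, hM]
  exact (LinearMap.injective_codRestrict_iff _).2 (hj.comp hmkQ)

theorem gvClosure_range_toWEnvelope : gvClosure (LinearMap.range (toWEnvelope j)) = ⊤ := by
  rw [toWEnvelope, LinearMap.range_codRestrict, LinearMap.range_comp_of_range_eq_top _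
    (Submodule.range_mkQ _)]
  exact gvClosure_submoduleOf_gvClosure _

theorem IsInjectiveEnvelope.isGVTorsionFree_wEnvelope (hj : IsInjectiveEnvelope j) :
    IsGVTorsionFree R (wEnvelope j) :=
  (hj.isGVTorsionFree isGVTorsionFree_quotient_torGV).of_injective _
    (wEnvelope j).injective_subtype

theorem IsWModule.toWEnvelope_bijective (hM : IsWModule R M) (hj : IsInjectiveEnvelope j) :
    Function.Bijective (toWEnvelope j) :=
  have hinj := toWEnvelope_injective hM.1 hj.2.1
  ⟨hinj, (isWModule_iff.1 hM).2.surjective hj.isGVTorsionFree_wEnvelope _ hinj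
    gvClosure_range_toWEnvelope⟩

end ToWEnvelope

theorem IsWSplit.isWProjective (hM : IsWSplit R M) (hM₀ : IsGVTorsionFree R M) :
    IsWProjective R M := by
  obtain ⟨E, _, _, j, hj⟩ := exists_isInjectiveEnvelope R (M ⧸ torGV R M)
  have hL : IsWSplit R (wEnvelope j) :=
    hM.of_gvClosure_range_eq_top hj.isGVTorsionFree_wEnvelope (toWEnvelope j)
      (toWEnvelope_injective hM₀ hj.2.1) gvClosure_range_toWEnvelope
  exact ⟨E, _, _, j, hj, fun N _ _ _ _ => hL.isGVTorsion_ext N⟩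

theorem IsGVTorsion.of_surjective {X Y : Type*} [AddCommGroup X] [Module R X] [AddCommGroup Y]
    [Module R Y] (hX : IsGVTorsion R X) (f : X →ₗ[R] Y) (hf : Function.Surjective f) :
    IsGVTorsion R Y := by
  have hker : gvClosure (LinearMap.ker f) = ⊤ :=
    top_le_iff.1 (hX.ge.trans (gvClosure_mono bot_le))
  refine Submodule.comap_injective_of_surjective hf ?_
  rw [torGV, ← gvClosure_comap, Submodule.comap_bot, hker, Submodule.comap_top]

theorem IsWProjective.isGVTorsion_ext (hproj : IsWProjective R M) (hw : IsWModule R M)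
    {N : Type u} [AddCommGroup N] [Module R N] [Module.IsTorsionFree R N] (hN : IsWModule R N) :
    IsGVTorsion R (Abelian.Ext (ModuleCat.of R M) (ModuleCat.of R N) 1) := by
  obtain ⟨E, _, _, j, hj, hExt⟩ := hproj
  let e : M ≃ₗ[R] wEnvelope j := LinearEquiv.ofBijective _ (hw.toWEnvelope_bijective hj)
  refine (hExt N inferInstance hN).of_surjective
    (Abelian.Ext.precompOfLinear (Abelian.Ext.mk₀ e.toModuleIso.hom) R (ModuleCat.of R N)
      (zero_add 1)) fun x =>
    ⟨(Abelian.Ext.mk₀ e.toModuleIso.inv).comp x (zero_add 1), ?_⟩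
  exact (Abelian.Ext.mk₀_comp_mk₀_assoc _ _ _).trans
    (by rw [Iso.hom_inv_id, Abelian.Ext.mk₀_id_comp])

theorem exists_comp_eq_smul_id {F : Type u} [AddCommGroup F] [Module R F] {g : F →ₗ[R] M}
    (hg : Function.Surjective g) {a : R}
    (ha : a • (LinearMap.shortExact_shortComplexKer hg).extClass = 0) :
    ∃ h : M →ₗ[R] F, g ∘ₗ h = a • LinearMap.id := by
  have hcomp : (Abelian.Ext.mk₀ (a • 𝟙 (ModuleCat.of R M))).comp
      (LinearMap.shortExact_shortComplexKer hg).extClass (zero_add 1) = 0 := by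
    rw [Abelian.Ext.mk₀_smul, Abelian.Ext.smul_comp]
    exact (congrArg (a • ·) (Abelian.Ext.mk₀_id_comp _)).trans ha
  obtain ⟨x, hx⟩ := Abelian.Ext.covariant_sequence_exact₃ _
    (LinearMap.shortExact_shortComplexKer hg) _ _ hcomp
  obtain ⟨h, rfl⟩ := (Abelian.Ext.mk₀_bijective _ _).2 x
  rw [Abelian.Ext.mk₀_comp_mk₀] at hx
  exact ⟨h.hom, congrArg ModuleCat.Hom.hom ((Abelian.Ext.mk₀_bijective _ _).1 hx)⟩

theorem exists_isWSplitting_of_isGVTorsion_ext {F : Type u} [AddCommGroup F] [Module R F]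
    {g : F →ₗ[R] M} (hg : Function.Surjective g)
    (hExt : IsGVTorsion R
      (Abelian.Ext (ModuleCat.of R M) (ModuleCat.of R (LinearMap.ker g)) 1)) :
    ∃ (n : ℕ) (d : Fin n → R) (h : Fin n → M →ₗ[R] F), IsWSplitting g d h := by
  have hmem : (LinearMap.shortExact_shortComplexKer hg).extClass ∈ torGV R _ :=
    hExt.ge Submodule.mem_top
  obtain ⟨n, d, hd, hzero⟩ := mem_gvClosure_iff_exists_fin.1 hmem
  choose h hh using fun k => exists_comp_eq_smul_id hg ((Submodule.mem_bot R).1 (hzero k))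
  exact ⟨n, d, h, hd, hh⟩

theorem IsWProjective.exists_isWSplitting {F : Type u} [AddCommGroup F] [Module R F]
    (hproj : IsWProjective R M) (hw : IsWModule R M) (hF : IsWModule R F)
    [Module.IsTorsionFree R F] {g : F →ₗ[R] M} (hg : Function.Surjective g) :
    ∃ (n : ℕ) (d : Fin n → R) (h : Fin n → M →ₗ[R] F), IsWSplitting g d h :=
  exists_isWSplitting_of_isGVTorsion_ext hg
    (hproj.isGVTorsion_ext hw (hF.of_gvClosure_eq (gvClosure_ker hw.1 g)))

end WProjective

section CountablyGenerated

variable {R : Type u} [CommRing R] {M N : Type*} [AddCommGroup M] [Module R M]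
  [AddCommGroup N] [Module R N]

theorem IsCountablyGenerated.of_surjective (hM : IsCountablyGenerated R M) (f : M →ₗ[R] N)
    (hf : Function.Surjective f) : IsCountablyGenerated R N := by
  obtain ⟨s, hs, hspan⟩ := hM
  refine ⟨f '' s, hs.image f, ?_⟩
  rw [Submodule.span_image, hspan, Submodule.map_top, LinearMap.range_eq_top.2 hf]

theorem isCountablyGenerated_self : IsCountablyGenerated R R :=
  ⟨{1}, Set.countable_singleton 1, Ideal.span_singleton_one⟩

theorem IsCountablyGenerated.map {S : Submodule R M} (hS : IsCountablyGenerated R S)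
    (f : M →ₗ[R] N) : IsCountablyGenerated R (S.map f) :=
  hS.of_surjective (f.submoduleMap S) (f.submoduleMap_surjective S)

theorem isCountablyGenerated_submodule_iff {S : Submodule R M} :
    IsCountablyGenerated R S ↔ ∃ t : Set M, t.Countable ∧ Submodule.span R t = S := by
  constructor
  · rintro ⟨s, hs, hspan⟩
    refine ⟨S.subtype '' s, hs.image _, ?_⟩
    rw [Submodule.span_image, hspan, Submodule.map_top, Submodule.range_subtype]
  · rintro ⟨t, ht, rfl⟩
    exact ⟨Subtype.val ⁻¹' t, ht.preimage Subtype.val_injective, Submodule.span_span_coe_preimage⟩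

theorem isCountablyGenerated_biSup {ι : Type*} {S : ι → Submodule R M} {C : Set ι}
    (hC : C.Countable) (hS : ∀ i, IsCountablyGenerated R (S i)) :
    IsCountablyGenerated R (⨆ i ∈ C, S i : Submodule R M) := by
  choose t ht htS using fun i => isCountablyGenerated_submodule_iff.1 (hS i)
  refine isCountablyGenerated_submodule_iff.2 ⟨⋃ i ∈ C, t i, hC.biUnion fun i _ => ht i, ?_⟩
  simp_rw [Submodule.span_iUnion, htS]

theorem IsCountablyGenerated.exists_countable_le_biSup {ι : Type*} {S : ι → Submodule R M}
    {T : Submodule R M} (hT : IsCountablyGenerated R T) (hTS : T ≤ ⨆ i, S i) :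
    ∃ C : Set ι, C.Countable ∧ T ≤ ⨆ i ∈ C, S i := by
  obtain ⟨t, ht, rfl⟩ := isCountablyGenerated_submodule_iff.1 hT
  have hfin : ∀ x ∈ t, ∃ c : Finset ι, x ∈ ⨆ i ∈ c, S i := fun x hx =>
    Submodule.exists_finset_of_mem_iSup S (hTS (Submodule.subset_span hx))
  choose! c hc using hfin
  refine ⟨⋃ x ∈ t, (c x : Set ι), ht.biUnion fun x _ => (c x).countable_toSet, ?_⟩
  refine Submodule.span_le.2 fun x hx => ?_
  have hmono : (⨆ i ∈ c x, S i) ≤ ⨆ i ∈ ⋃ x ∈ t, (c x : Set ι), S i :=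
    biSup_mono fun i hi => Set.mem_biUnion hx hi
  exact hmono (hc x hx)

end CountablyGenerated

section WIsomorphism

variable {R : Type u} [CommRing R]

theorem IsMaximalWIdeal.not_le {m : Ideal R} (hm : IsMaximalWIdeal m) {J : Ideal R}
    (hJ : IsGVIdeal J) : ¬ J ≤ m := by
  intro hJm
  have hclosed : gvClosure m = m :=
    (isWModule_iff.1 hm.prop.2).2.gvClosure_eq isGVTorsionFree_self
  have hone : (1 : R) ∈ gvClosure m := ⟨J, hJ, fun a ha => by simpa using hJm ha⟩
  exact hm.prop.1 ((Ideal.eq_top_iff_one m).2 (hclosed ▸ hone))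

theorem isWIsomorphism_subtype {M : Type u} [AddCommGroup M] [Module R M] {S : Submodule R M}
    (hS : gvClosure S = ⊤) : IsWIsomorphism S.subtype := by
  intro m _ hm
  refine ⟨LocalizedModule.map_injective _ _ S.injective_subtype, fun y => ?_⟩
  induction y using LocalizedModule.induction_on with
  | h x t =>
    obtain ⟨J, hJ, hx⟩ : x ∈ gvClosure S := hS ▸ trivial
    obtain ⟨a, haJ, ham⟩ := Set.not_subset.1 (hm.not_le hJ)
    refine ⟨LocalizedModule.mk ⟨a • x, hx a haJ⟩ ((⟨a, ham⟩ : m.primeCompl) * t), ?_⟩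
    rw [LocalizedModule.map_mk]
    exact LocalizedModule.mk_cancel_common_left (⟨a, ham⟩ : m.primeCompl) t x

theorem IsWSplitting.isWCountablyGenerated {B C : Type u} [AddCommGroup B] [Module R B]
    [AddCommGroup C] [Module R C] {g : B →ₗ[R] C} {n : ℕ} {d : Fin n → R}
    {h : Fin n → C →ₗ[R] B} (hs : IsWSplitting g d h) (hB : IsCountablyGenerated R B) :
    IsWCountablyGenerated R C :=
  ⟨LinearMap.range g, inferInstance, inferInstance, (LinearMap.range g).subtype,
    hB.of_surjective g.rangeRestrict g.surjective_rangeRestrict,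
    isWIsomorphism_subtype hs.gvClosure_range⟩

end WIsomorphism

section Subquotient

variable {R : Type u} [CommRing R]

/-- The map `S / (S' ∩ S) → T / (T' ∩ T)` induced by `f`. For `S' ≤ S` and `T' ≤ T` these are the
quotients `S / S'` and `T / T'`. -/
def subquotientMap {M N : Type*} [AddCommGroup M] [Module R M] [AddCommGroup N] [Module R N]
    (f : M →ₗ[R] N) {S S' : Submodule R M} {T T' : Submodule R N}
    (hS : S ≤ T.comap f) (hS' : S' ≤ T'.comap f) :
    (S ⧸ S'.submoduleOf S) →ₗ[R] T ⧸ T'.submoduleOf T :=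
  (S'.submoduleOf S).mapQ (T'.submoduleOf T) (f.restrict hS) fun _ hx => hS' hx

theorem subquotientMap_surjective {M N : Type*} [AddCommGroup M] [Module R M] [AddCommGroup N]
    [Module R N] {f : M →ₗ[R] N} {S S' : Submodule R M} {T T' : Submodule R N}
    (hS : S ≤ T.comap f) (hS' : S' ≤ T'.comap f) (hf : Function.Surjective (f.restrict hS)) :
    Function.Surjective (subquotientMap f hS hS') :=
  .of_comp (g := (S'.submoduleOf S).mkQ) ((T'.submoduleOf T).mkQ_surjective.comp hf)

theorem IsWSplitting.subquotient {B C : Type u} [AddCommGroup B] [Module R B]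
    [AddCommGroup C] [Module R C] {g : B →ₗ[R] C} {n : ℕ} {d : Fin n → R}
    {h : Fin n → C →ₗ[R] B} (hs : IsWSplitting g d h) {S S' : Submodule R B}
    {T T' : Submodule R C} (hg : S ≤ T.comap g) (hg' : S' ≤ T'.comap g)
    (hh : ∀ k, T ≤ S.comap (h k)) (hh' : ∀ k, T' ≤ S'.comap (h k)) :
    IsWSplitting (subquotientMap g hg hg') d fun k => subquotientMap (h k) (hh k) (hh' k) :=
  (hs.restrict hg hh).mapQ _ fun k _ hx => hh' k hx

theorem nonempty_linearEquiv_quotient_submoduleOf {M : Type*} [AddCommGroup M] [Module R M]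
    {p q r : Submodule R M} (hdisj : Disjoint p q) (hsup : p ⊔ q = r) :
    Nonempty (p ≃ₗ[R] r ⧸ q.submoduleOf r) := by
  subst hsup
  have hbot : (p ⊓ q).comap p.subtype = ⊥ := by
    rw [hdisj.eq_bot, Submodule.comap_bot, Submodule.ker_subtype]
  exact ⟨(Submodule.quotEquivOfEqBot _ hbot).symm.trans
    (LinearMap.quotientInfEquivSupQuotient p q)⟩

end Subquotient

section ClosedExhaustion

variable {ι : Type u} (s : ι → Set ι)

/-- The smallest set that contains `i` and, with any of its elements `j`, the set `s j`. -/
def reachable (i : ι) : Set ι :=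
  {j | Relation.ReflTransGen (fun a b => b ∈ s a) i j}

variable {s} in
theorem countable_reachable (hs : ∀ i, (s i).Countable) (i : ι) : (reachable s i).Countable := by
  let T : ℕ → Set ι := fun n => Nat.rec {i} (fun _ U => ⋃ j ∈ U, s j) n
  have hT : ∀ n, (T n).Countable := fun n => by
    induction n with
    | zero => exact Set.countable_singleton i
    | succ n ih => exact ih.biUnion fun j _ => hs j
  refine (Set.countable_iUnion hT).mono fun j hj => ?_
  induction hj with
  | refl => exact Set.mem_iUnion.2 ⟨0, rfl⟩
  | tail _ hjk ih =>
    obtain ⟨n, hn⟩ := Set.mem_iUnion.1 ih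
    exact Set.mem_iUnion.2 ⟨n + 1, Set.mem_biUnion hn hjk⟩

/-- The union of the sets `reachable s i` over the first `l` elements `i` of a well-ordering
of `ι`. -/
def closedExhaustion (l : Ordinal.{u}) : Set ι :=
  {j | ∃ i, Ordinal.typein (WellOrderingRel (α := ι)) i < l ∧ j ∈ reachable s i}

theorem closedExhaustion_monotone : Monotone (closedExhaustion s) :=
  fun _ _ hlm _ ⟨i, hi, hj⟩ => ⟨i, hi.trans_le hlm, hj⟩

theorem closedExhaustion_zero : closedExhaustion s 0 = ∅ :=
  Set.eq_empty_of_forall_notMem fun _ ⟨_, hi, _⟩ => not_lt_bot hi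

theorem closedExhaustion_type :
    closedExhaustion s (Ordinal.type (WellOrderingRel (α := ι))) = Set.univ :=
  Set.eq_univ_of_forall fun j => ⟨j, Ordinal.typein_lt_type _ j, .refl⟩

theorem closedExhaustion_of_isSuccLimit {l : Ordinal.{u}} (hl : Order.IsSuccLimit l) :
    closedExhaustion s l = ⋃ m : Set.Iio l, closedExhaustion s m := by
  refine (Set.iUnion_subset fun m => closedExhaustion_monotone s m.2.le).antisymm' ?_
  rintro j ⟨i, hi, hj⟩
  exact Set.mem_iUnion.2 ⟨⟨_, hl.succ_lt hi⟩, i, Order.lt_succ _, hj⟩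

variable {s} in
theorem subset_closedExhaustion {l : Ordinal.{u}} {j : ι} (hj : j ∈ closedExhaustion s l) :
    s j ⊆ closedExhaustion s l := by
  obtain ⟨i, hi, hij⟩ := hj
  exact fun k hk => ⟨i, hi, hij.tail hk⟩

variable {s} in
theorem countable_closedExhaustion_diff (hs : ∀ i, (s i).Countable) (l : Ordinal.{u}) :
    (closedExhaustion s (l + 1) \ closedExhaustion s l).Countable := by
  refine (Set.Subsingleton.countable (s := {i | Ordinal.typein WellOrderingRel i = l})
    fun i hi i' hi' => Ordinal.typein_injective _ (hi.trans hi'.symm)).biUnion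
    (fun i _ => countable_reachable hs i) |>.mono ?_
  rintro j ⟨⟨i, hi, hij⟩, hj⟩
  have hil : Ordinal.typein WellOrderingRel i = l :=
    (Order.lt_add_one_iff.1 hi).eq_of_not_lt fun hlt => hj ⟨i, hlt, hij⟩
  exact Set.mem_biUnion hil hij

end ClosedExhaustion

section ContinuousChain

variable {R : Type u} [CommRing R] {M : Type u} [AddCommGroup M] [Module R M]
  {A : Ordinal.{u} → Submodule R M}

theorem isContinuousChain_of_monotone (hA : Monotone A) (hA₀ : A 0 = ⊥)
    (hlim : ∀ l, Order.IsSuccLimit l → A l = ⨆ m : Set.Iio l, A m) (α : Ordinal.{u}) :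
    IsContinuousChain α A := by
  refine ⟨hA₀, fun l _ => hA le_self_add, fun l _ hl x => ?_⟩
  have : Nonempty (Set.Iio l) := ⟨⊥, hl.bot_lt⟩
  have hdir : Directed (· ≤ ·) fun m : Set.Iio l => A m :=
    (hA.comp (Subtype.mono_coe _)).directed_le
  rw [hlim l hl, Submodule.mem_iSup_of_directed _ hdir]
  exact ⟨fun ⟨m, hx⟩ => ⟨m, m.2, hx⟩, fun ⟨m, hm, hx⟩ => ⟨⟨m, hm⟩, hx⟩⟩

theorem isContinuousChain_gvClosure (hM : IsGVTorsionFree R M) (hA : Monotone A) (hA₀ : A 0 = ⊥)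
    (hlim : ∀ l, Order.IsSuccLimit l → A l = ⨆ m : Set.Iio l, A m) (α : Ordinal.{u}) :
    IsContinuousChain α fun l => gvClosure (A l) := by
  refine isContinuousChain_of_monotone (fun _ _ hlm => gvClosure_mono (hA hlm))
    ((congrArg gvClosure hA₀).trans hM) (fun l hl => ?_) α
  have : Nonempty (Set.Iio l) := ⟨⊥, hl.bot_lt⟩
  rw [hlim l hl]
  exact gvClosure_iSup_of_directed (hA.comp (Subtype.mono_coe _)).directed_le

end ContinuousChain

theorem IsWProjective.nonempty_wSplitPresentation {R : Type u} [CommRing R] {M : Type u}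
    [AddCommGroup M] [Module R M] (hproj : IsWProjective R M) (hw : IsWModule R M) :
    Nonempty (WSplitPresentation R M) := by
  let g : (M →₀ R) →ₗ[R] M := Finsupp.linearCombination R id
  have hg : Function.Surjective g := Finsupp.linearCombination_id_surjective R M
  obtain ⟨n, d, h, hs⟩ := hproj.exists_isWSplitting hw isWModule_of_projective hg
  let e (i : M) : R ≃ₗ[R] LinearMap.range (Finsupp.lsingle i : R →ₗ[R] M →₀ R) :=
    LinearEquiv.ofInjective _ (Finsupp.single_injective i)
  exact ⟨{
    P := LinearMap.ker g
    F := M →₀ R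
    f := (LinearMap.ker g).subtype
    g := g
    f_injective := Subtype.val_injective
    exact := LinearMap.exact_subtype_ker_map g
    g_surjective := hg
    n := n
    d := d
    h := h
    splitting := hs
    I := M
    component := fun i => LinearMap.range (Finsupp.lsingle i)
    independent := iSupIndep_range_lsingle M R R
    iSup_component := Finsupp.iSup_lsingle_range
    projective := fun i => Module.Projective.of_equiv (e i)
    countablyGenerated := fun i =>
      isCountablyGenerated_self.of_surjective (e i).toLinearMap (e i).surjective }⟩

namespace WSplitPresentation

variable {R : Type u} [CommRing R] {M : Type u} [AddCommGroup M] [Module R M]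
  (ξ : WSplitPresentation R M)

theorem subF_mono {H H' : Set ξ.I} (h : H ⊆ H') : ξ.subF H ≤ ξ.subF H' :=
  biSup_mono fun _ hi => h hi

theorem subM_mono {H H' : Set ξ.I} (h : H ⊆ H') : ξ.subM H ≤ ξ.subM H' :=
  Submodule.map_mono (ξ.subF_mono h)

theorem subF_union (H H' : Set ξ.I) : ξ.subF (H ∪ H') = ξ.subF H ⊔ ξ.subF H' :=
  iSup_union

theorem subF_univ : ξ.subF Set.univ = ⊤ := by
  rw [subF, iSup_univ, ξ.iSup_component]

theorem subM_univ : ξ.subM Set.univ = ⊤ := by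
  rw [subM, subF_univ, Submodule.map_top, LinearMap.range_eq_top.2 ξ.g_surjective]

theorem subM_empty : ξ.subM ∅ = ⊥ := by
  rw [subM, subF, iSup_emptyset, Submodule.map_bot]

theorem subM_iUnion {κ : Type*} (H : κ → Set ξ.I) : ξ.subM (⋃ i, H i) = ⨆ i, ξ.subM (H i) := by
  rw [subM, subF, iSup_iUnion, Submodule.map_iSup]
  rfl

theorem subF_le_comap_subM (H : Set ξ.I) : ξ.subF H ≤ (ξ.subM H).comap ξ.g :=
  Submodule.le_comap_map ξ.g _

theorem disjoint_subF {H H' : Set ξ.I} (h : Disjoint H H') : Disjoint (ξ.subF H) (ξ.subF H') :=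
  ξ.independent.disjoint_biSup_biSup h

theorem isCompl_subF (H : Set ξ.I) : IsCompl (ξ.subF H) (ξ.subF Hᶜ) :=
  ⟨ξ.disjoint_subF disjoint_compl_right, codisjoint_iff.2 (by
    rw [← subF_union, Set.union_compl_self, subF_univ])⟩

instance projective_F : Module.Projective R ξ.F := by
  classical
  have := ξ.projective
  exact Module.Projective.of_equiv (LinearEquiv.ofBijective
    (DirectSum.coeLinearMap ξ.component)
    (DirectSum.isInternal_submodule_of_iSupIndep_of_iSup_eq_top ξ.independent ξ.iSup_component))

instance projective_subF (H : Set ξ.I) : Module.Projective R (ξ.subF H) :=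
  Module.Projective.of_split (ξ.subF H).subtype (Submodule.projectionOnto _ _ (ξ.isCompl_subF H))
    (LinearMap.ext fun x => Submodule.projectionOnto_apply_left (ξ.isCompl_subF H) x)

theorem gvClosure_subF (H : Set ξ.I) : gvClosure (ξ.subF H) = ξ.subF H := by
  have hker := gvClosure_ker isGVTorsionFree_of_projective
    (Submodule.projectionOnto _ _ (ξ.isCompl_subF H).symm)
  rwa [Submodule.ker_projectionOnto] at hker

variable {ξ} in
theorem nonempty_subF_diff_equiv {H H' : Set ξ.I} (hH : H ⊆ H') :
    Nonempty (ξ.subF (H' \ H) ≃ₗ[R] ξ.subF H' ⧸ (ξ.subF H).submoduleOf (ξ.subF H')) :=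
  nonempty_linearEquiv_quotient_submoduleOf (ξ.disjoint_subF Set.disjoint_sdiff_left) (by
    rw [← subF_union, Set.sdiff_union_of_subset hH])

variable {ξ} in
theorem projective_subF_quotient {H H' : Set ξ.I} (hH : H ⊆ H') :
    Module.Projective R (ξ.subF H' ⧸ (ξ.subF H).submoduleOf (ξ.subF H')) :=
  let ⟨e⟩ := nonempty_subF_diff_equiv hH
  Module.Projective.of_equiv e

variable {ξ} in
theorem isCountablyGenerated_subF_quotient {H H' : Set ξ.I} (hH : H ⊆ H')
    (hcount : (H' \ H).Countable) :
    IsCountablyGenerated R (ξ.subF H' ⧸ (ξ.subF H).submoduleOf (ξ.subF H')) :=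
  let ⟨e⟩ := nonempty_subF_diff_equiv hH
  (isCountablyGenerated_biSup hcount ξ.countablyGenerated).of_surjective e.toLinearMap e.surjective

variable {ξ} in
theorem isCountablyGenerated_subM_quotient {H H' : Set ξ.I} (hle : H ⊆ H')
    (hcount : (H' \ H).Countable) :
    IsCountablyGenerated R (ξ.subM H' ⧸ (ξ.subM H).submoduleOf (ξ.subM H')) :=
  (isCountablyGenerated_subF_quotient hle hcount).of_surjective
    (subquotientMap ξ.g (ξ.subF_le_comap_subM H') (ξ.subF_le_comap_subM H))
    (subquotientMap_surjective _ _ (ξ.g.submoduleMap_surjective _))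

theorem exists_countable_component_le_comap : ∃ s : ξ.I → Set ξ.I, (∀ i, (s i).Countable) ∧
    ∀ i k, ξ.component i ≤ (ξ.subF (s i)).comap (ξ.h k ∘ₗ ξ.g) := by
  have hsupp (i : ξ.I) (k : Fin ξ.n) : ∃ C : Set ξ.I, C.Countable ∧
      (ξ.component i).map (ξ.h k ∘ₗ ξ.g) ≤ ξ.subF C :=
    ((ξ.countablyGenerated i).map _).exists_countable_le_biSup (ξ.iSup_component ▸ le_top)
  choose C hC hle using hsupp
  refine ⟨fun i => ⋃ k, C i k, fun i => Set.countable_iUnion (hC i), fun i k => ?_⟩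
  exact Submodule.map_le_iff_le_comap.1
    ((hle i k).trans (ξ.subF_mono (Set.subset_iUnion (C i) k)))

variable {ξ} in
theorem isInduced_of_forall_subset {s : ξ.I → Set ξ.I}
    (hs : ∀ i k, ξ.component i ≤ (ξ.subF (s i)).comap (ξ.h k ∘ₗ ξ.g)) {H : Set ξ.I}
    (hH : ∀ i ∈ H, s i ⊆ H) : ξ.IsInduced H := fun k =>
  Submodule.map_le_iff_le_comap.2 <| iSup₂_le fun i hi =>
    (hs i k).trans (Submodule.comap_mono (ξ.subF_mono (hH i hi)))

namespace IsInduced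

variable {ξ} {H H' : Set ξ.I}

theorem gvClosure_le_comap (hH : ξ.IsInduced H) (k : Fin ξ.n) :
    gvClosure (ξ.subM H) ≤ (ξ.subF H).comap (ξ.h k) := by
  rw [← ξ.gvClosure_subF H, ← gvClosure_comap]
  exact gvClosure_mono (hH k)

theorem isWSplit_gvClosure (hH : ξ.IsInduced H) : IsWSplit R (gvClosure (ξ.subM H)) :=
  (ξ.splitting.restrict
    ((ξ.subF_le_comap_subM H).trans (Submodule.comap_mono (le_gvClosure _)))
    hH.gvClosure_le_comap).isWSplit

theorem isWProjective_gvClosure (hH : ξ.IsInduced H) (hM : IsGVTorsionFree R M) :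
    IsWProjective R (gvClosure (ξ.subM H)) :=
  hH.isWSplit_gvClosure.isWProjective (hM.of_injective _ (Submodule.injective_subtype _))

theorem isWSplit_quotient (hH : ξ.IsInduced H) (hH' : ξ.IsInduced H') (hle : H ⊆ H') :
    IsWSplit R (ξ.subM H' ⧸ (ξ.subM H).submoduleOf (ξ.subM H')) :=
  have := projective_subF_quotient hle
  (ξ.splitting.subquotient (ξ.subF_le_comap_subM H') (ξ.subF_le_comap_subM H) hH' hH).isWSplit

theorem isWSplitting_quotient_gvClosure (hH : ξ.IsInduced H) (hH' : ξ.IsInduced H') :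
    IsWSplitting
      (subquotientMap ξ.g
        ((ξ.subF_le_comap_subM H').trans (Submodule.comap_mono (le_gvClosure _)))
        ((ξ.subF_le_comap_subM H).trans (Submodule.comap_mono (le_gvClosure _)))) ξ.d
      fun k => subquotientMap (ξ.h k) (hH'.gvClosure_le_comap k) (hH.gvClosure_le_comap k) :=
  ξ.splitting.subquotient _ _ _ _

theorem isWCountablyGenerated_quotient_gvClosure (hH : ξ.IsInduced H) (hH' : ξ.IsInduced H')
    (hle : H ⊆ H') (hcount : (H' \ H).Countable) :
    IsWCountablyGenerated R (gvClosure (ξ.subM H') ⧸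
      (gvClosure (ξ.subM H)).submoduleOf (gvClosure (ξ.subM H'))) :=
  (hH.isWSplitting_quotient_gvClosure hH').isWCountablyGenerated
    (isCountablyGenerated_subF_quotient hle hcount)

theorem isWProjective_quotient_gvClosure (hH : ξ.IsInduced H) (hH' : ξ.IsInduced H')
    (hle : H ⊆ H') :
    IsWProjective R (gvClosure (ξ.subM H') ⧸
      (gvClosure (ξ.subM H)).submoduleOf (gvClosure (ξ.subM H'))) :=
  have := projective_subF_quotient hle
  (hH.isWSplitting_quotient_gvClosure hH').isWSplit.isWProjective (isGVTorsionFree_quotient (by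
    rw [Submodule.submoduleOf, gvClosure_comap, gvClosure_gvClosure]))

end IsInduced

section Filtration

variable (s : ξ.I → Set ξ.I)

theorem monotone_subM_closedExhaustion : Monotone fun l => ξ.subM (closedExhaustion s l) :=
  fun _ _ hlm => ξ.subM_mono (closedExhaustion_monotone s hlm)

theorem subM_closedExhaustion_of_isSuccLimit {l : Ordinal.{u}} (hl : Order.IsSuccLimit l) :
    ξ.subM (closedExhaustion s l) = ⨆ m : Set.Iio l, ξ.subM (closedExhaustion s m) := by
  rw [closedExhaustion_of_isSuccLimit s hl, subM_iUnion]

theorem isContinuousChain_subM_closedExhaustion (α : Ordinal.{u}) :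
    IsContinuousChain α fun l => ξ.subM (closedExhaustion s l) :=
  isContinuousChain_of_monotone (ξ.monotone_subM_closedExhaustion s)
    (by rw [closedExhaustion_zero, subM_empty])
    (fun _ hl => ξ.subM_closedExhaustion_of_isSuccLimit s hl) α

theorem isContinuousChain_gvClosure_subM_closedExhaustion (hM : IsGVTorsionFree R M)
    (α : Ordinal.{u}) :
    IsContinuousChain α fun l => gvClosure (ξ.subM (closedExhaustion s l)) :=
  isContinuousChain_gvClosure hM (ξ.monotone_subM_closedExhaustion s)
    (by rw [closedExhaustion_zero, subM_empty])
    (fun _ hl => ξ.subM_closedExhaustion_of_isSuccLimit s hl) α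

end Filtration

theorem isFilteredByCGWSplit_top : ξ.IsFilteredByCGWSplit ⊤ := by
  obtain ⟨s, hs, hξ⟩ := ξ.exists_countable_component_le_comap
  have hind (l : Ordinal.{u}) : ξ.IsInduced (closedExhaustion s l) :=
    isInduced_of_forall_subset hξ fun _ => subset_closedExhaustion
  have hle (l : Ordinal.{u}) : closedExhaustion s l ⊆ closedExhaustion s (l + 1) :=
    closedExhaustion_monotone s le_self_add
  refine ⟨Ordinal.type (WellOrderingRel (α := ξ.I)), Set.univ, closedExhaustion s,
    fun _ _ => Set.subset_univ _, closedExhaustion_zero s, closedExhaustion_type s,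
    ξ.isContinuousChain_subM_closedExhaustion s _, ?_, fun l _ => hind l, fun l _ => ⟨?_, ?_⟩⟩
  · rw [closedExhaustion_type, subM_univ]
  · exact isCountablyGenerated_subM_quotient (hle l) (countable_closedExhaustion_diff hs l)
  · exact (hind l).isWSplit_quotient (hind _) (hle l)

theorem isFilteredByWCGWProjective (ξ : WSplitPresentation R M) (hw : IsWModule R M) :
    IsFilteredByWCGWProjective R M := by
  obtain ⟨s, hs, hξ⟩ := ξ.exists_countable_component_le_comap
  have hind (l : Ordinal.{u}) : ξ.IsInduced (closedExhaustion s l) :=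
    isInduced_of_forall_subset hξ fun _ => subset_closedExhaustion
  have hle (l : Ordinal.{u}) : closedExhaustion s l ⊆ closedExhaustion s (l + 1) :=
    closedExhaustion_monotone s le_self_add
  refine ⟨Ordinal.type (WellOrderingRel (α := ξ.I)),
    fun l => gvClosure (ξ.subM (closedExhaustion s l)),
    ξ.isContinuousChain_gvClosure_subM_closedExhaustion s hw.1 _, ?_,
    fun l _ => ⟨(hind l).isWProjective_gvClosure hw.1, ?_⟩, fun l _ => ⟨?_, ?_⟩⟩
  · simp only [closedExhaustion_type, subM_univ, gvClosure_top]
  · exact hw.of_gvClosure_eq (gvClosure_gvClosure _)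
  · exact (hind l).isWCountablyGenerated_quotient_gvClosure (hind _) (hle l)
      (countable_closedExhaustion_diff hs l)
  · exact (hind l).isWProjective_quotient_gvClosure (hind _) (hle l)

end WSplitPresentation

end WKaplansky

/-- The `w`-version of Kaplansky's theorem. -/
theorem theorem3p5 {R : Type u} [CommRing R] {M : Type u} [AddCommGroup M] [Module R M]
    (hproj : WKaplansky.IsWProjective R M) (hw : WKaplansky.IsWModule R M) :
    (Nonempty (WKaplansky.WSplitPresentation R M) ∧
      ∀ ξ : WKaplansky.WSplitPresentation R M, ξ.IsFilteredByCGWSplit ⊤) ∧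
    WKaplansky.IsFilteredByWCGWProjective R M := by
  obtain ⟨ξ⟩ := hproj.nonempty_wSplitPresentation hw
  exact ⟨⟨⟨ξ⟩, fun ξ => ξ.isFilteredByCGWSplit_top⟩, ξ.isFilteredByWCGWProjective hw⟩
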